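/- Let $k$ be an algebraically closed field, let $n, l \ge 0$, and let $i\colon C\hookrightarrow \mathbb{P}^n_k$ be a reduced closed subscheme with ideal sheaf $\mathcal{I}$. Suppose that $C$ is a local complete intersection in $\mathbb{P}^n_k$, i.e. for every point $c\in C$ the stalk $\mathcal{I}_c\subset\mathcal{O}_{\mathbb{P}^n,c}$ is generated by a regular sequence. Let $F\in k[x_0,\dots,x_n]$ be a nonzero homogeneous polynomial of degree $l$, let $V(F)\subset\mathbb{P}^n_k$ be the closed subscheme it defines, and let $V(F)_{\mathrm{sing}}$ be the set of points of $V(F)$ at which its local ring is not regular. Then $$C\subset V(F)_{\mathrm{sing}}\quad\Longleftrightarrow\quad F\in\Gamma(\mathbb{P}^n,\mathcal{I}^2(l)),$$ where $C\subset V(F)_{\mathrm{sing}}$ means that every point of $C$ lies in $V(F)_{\mathrm{sing}}$, and $F$ is regarded as a global section of $\mathcal{O}_{\mathbb{P}^n}(l)\supset\mathcal{I}^2(l)$. -/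

import Mathlib

open CategoryTheory AlgebraicGeometry TopologicalSpace

universe u

namespace SingularAlong

noncomputable section

/-- The standard grading of `k[x_0, ..., x_n]` by degree. -/
abbrev grading (k : Type u) [Field k] (n : ℕ) : ℕ → Submodule k (MvPolynomial (Fin (n + 1)) k) :=
  MvPolynomial.homogeneousSubmodule (Fin (n + 1)) k

instance (k : Type u) [Field k] (n : ℕ) : GradedAlgebra (grading k n) :=
  MvPolynomial.gradedAlgebra

/-- Projective `n`-space over `k`, as the scheme `Proj k[x_0, ..., x_n]`. -/
abbrev PSpace (k : Type u) [Field k] (n : ℕ) : Scheme.{u} := Proj (grading k n)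

variable {k : Type u} [Field k] {n : ℕ}

lemma X_mem_grading (i : Fin (n + 1)) : (MvPolynomial.X i : MvPolynomial (Fin (n + 1)) k) ∈
    grading k n 1 :=
  MvPolynomial.isHomogeneous_X k i

/-- The coordinate ring `k[x_0/x_i, ..., x_n/x_i]` of the standard chart `D_+(x_i)`. -/
abbrev ChartRing (k : Type u) [Field k] {n : ℕ} (i : Fin (n + 1)) : Type u :=
  HomogeneousLocalization.Away (grading k n) (MvPolynomial.X i)

/-- The standard open subset `D_+(x_i)` of projective space. -/
def chart (k : Type u) [Field k] {n : ℕ} (i : Fin (n + 1)) : (PSpace k n).Opens :=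
  Proj.basicOpen (grading k n) (MvPolynomial.X i)

/-- `D_+(x_i)` as an affine open. -/
def affineChart (k : Type u) [Field k] {n : ℕ} (i : Fin (n + 1)) : (PSpace k n).affineOpens :=
  ⟨chart k i, Proj.isAffineOpen_basicOpen (grading k n) _ (X_mem_grading i) one_pos⟩

/-- The open immersion `Spec k[x_0/x_i, ..., x_n/x_i] ⟶ ℙⁿ` with image `D_+(x_i)`. -/
def chartι (k : Type u) [Field k] {n : ℕ} (i : Fin (n + 1)) :
    Spec (.of (ChartRing k i)) ⟶ PSpace k n :=
  Proj.awayι (grading k n) (MvPolynomial.X i) (X_mem_grading i) one_pos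

/-- The dehomogenization `F / x_i ^ l` of a form `F` of degree `l`. -/
def dehomogenize {l : ℕ} (F : MvPolynomial (Fin (n + 1)) k) (hF : F.IsHomogeneous l)
    (i : Fin (n + 1)) : ChartRing k i :=
  HomogeneousLocalization.Away.mk (grading k n) (X_mem_grading i) l F (by simpa using hF)

/-- The dehomogenization `F / x_i ^ l` as a regular function on `D_+(x_i)`. -/
def localSection {l : ℕ} (F : MvPolynomial (Fin (n + 1)) k) (hF : F.IsHomogeneous l)
    (i : Fin (n + 1)) : Γ(PSpace k n, chart k i) :=
  (Proj.awayToSection (grading k n) (MvPolynomial.X i)).hom (dehomogenize F hF i)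

/-- The restriction of functions from an open `U` to a smaller open `V`. -/
def restr {X : Scheme.{u}} {U V : X.Opens} (h : V ≤ U) : Γ(X, U) →+* Γ(X, V) :=
  (X.presheaf.map (homOfLE h).op).hom

/-- The group of global sections `Γ(ℙⁿ, 𝒥(l))` of the twist of an ideal sheaf `𝒥`.
The sheaf `𝒥(l)` is glued from the sheaves `𝒥` on the charts `D_+(x_i)` along the transition
functions `(x_j / x_i) ^ l` of `𝒪(l)`. So a global section is a family `s_i ∈ Γ(D_+(x_i), 𝒥)` with
`s_i = (x_j / x_i) ^ l * s_j` on `D_+(x_i) ∩ D_+(x_j)`. -/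
def twistSections (J : (PSpace k n).IdealSheafData) (l : ℕ) :
    AddSubgroup (∀ i : Fin (n + 1), Γ(PSpace k n, chart k i)) where
  carrier := {s | (∀ i, s i ∈ J.ideal (affineChart k i)) ∧
    ∀ i j, restr (V := chart k i ⊓ chart k j) inf_le_left (s i) =
      restr inf_le_left (localSection (MvPolynomial.X j) (MvPolynomial.isHomogeneous_X k j) i) ^ l *
        restr inf_le_right (s j)}
  zero_mem' := ⟨fun i ↦ zero_mem _, fun i j ↦ by simp⟩
  add_mem' := by
    rintro s t ⟨hs, hs'⟩ ⟨ht, ht'⟩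
    exact ⟨fun i ↦ add_mem (hs i) (ht i), fun i j ↦ by
      simp only [Pi.add_apply, map_add, hs' i j, ht' i j, mul_add]⟩
  neg_mem' := by
    rintro s ⟨hs, hs'⟩
    exact ⟨fun i ↦ neg_mem (hs i), fun i j ↦ by
      simp only [Pi.neg_apply, map_neg, hs' i j, mul_neg]⟩

/-- The global section of `𝒪(l)` defined by a form `F` of degree `l`; in the trivialization over
`D_+(x_i)` it is `F / x_i ^ l`. -/
def formSection {l : ℕ} (F : MvPolynomial (Fin (n + 1)) k) (hF : F.IsHomogeneous l) :
    twistSections (⊤ : (PSpace k n).IdealSheafData) l :=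
  ⟨localSection F hF, fun _ ↦ trivial, fun i j ↦ by
    apply Subtype.ext
    funext x
    apply HomogeneousLocalization.val_injective
    let p : ProjectiveSpectrum (grading k n) := x.1
    have h : Localization.mk F ⟨MvPolynomial.X i ^ l, pow_mem (S := p.1.toIdeal.primeCompl)
        x.2.1 l⟩ =
        Localization.mk (MvPolynomial.X j) ⟨MvPolynomial.X i ^ 1,
          pow_mem (S := p.1.toIdeal.primeCompl) x.2.1 1⟩ ^ l *
        Localization.mk F ⟨MvPolynomial.X j ^ l,
          pow_mem (S := p.1.toIdeal.primeCompl) x.2.2 l⟩ := by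
      rw [Localization.mk_pow, Localization.mk_mul, Localization.mk_eq_mk_iff,
        Localization.r_iff_exists]
      exact ⟨1, by simp; ring⟩
    refine h.trans ?_
    let u : HomogeneousLocalization.AtPrime (grading k n) p.1.toIdeal :=
      (localSection (MvPolynomial.X j) (MvPolynomial.isHomogeneous_X k j) i).1 ⟨p, x.2.1⟩
    let v : HomogeneousLocalization.AtPrime (grading k n) p.1.toIdeal :=
      (localSection F hF j).1 ⟨p, x.2.2⟩
    change u.val ^ l * v.val = (u ^ l * v).val
    rw [HomogeneousLocalization.val_mul, HomogeneousLocalization.val_pow]⟩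

/-- The ideal sheaf of the hypersurface `V(F)`: the functions that vanish on all the affine
hypersurfaces `Spec (k[x_0/x_i, ..., x_n/x_i] / (F / x_i ^ l))`. -/
def hypersurfaceIdeal {l : ℕ} (F : MvPolynomial (Fin (n + 1)) k) (hF : F.IsHomogeneous l) :
    (PSpace k n).IdealSheafData :=
  ⨅ i, (Spec.map (CommRingCat.ofHom
    (Ideal.Quotient.mk (Ideal.span {dehomogenize F hF i}))) ≫ chartι k i).ker

/-- The hypersurface `V(F)`, as a closed subscheme of projective space. -/
def hypersurface {l : ℕ} (F : MvPolynomial (Fin (n + 1)) k) (hF : F.IsHomogeneous l) :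
    Scheme.{u} :=
  (hypersurfaceIdeal F hF).subscheme

/-- The inclusion of `V(F)` into projective space. -/
def hypersurfaceι {l : ℕ} (F : MvPolynomial (Fin (n + 1)) k) (hF : F.IsHomogeneous l) :
    hypersurface F hF ⟶ PSpace k n :=
  (hypersurfaceIdeal F hF).subschemeι

/-- The set of singular points of a scheme: the points whose local ring is not regular. -/
def singularLocus (X : Scheme.{u}) : Set X :=
  {x | ¬ IsRegularLocalRing (X.presheaf.stalk x)}

/-- A closed immersion `i : C ⟶ X` makes `C` a local complete intersection in `X` if, at each point
of `C`, the stalk of its ideal sheaf (the kernel of `𝒪_{X, i c} → 𝒪_{C, c}`) is generated by a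
regular sequence of `𝒪_{X, i c}`. -/
def IsLocalCompleteIntersection {C X : Scheme.{u}} (i : C ⟶ X) : Prop :=
  ∀ c : C, ∃ rs : List (X.presheaf.stalk (i c)),
    RingTheory.Sequence.IsRegular (X.presheaf.stalk (i c)) rs ∧
      Ideal.ofList rs = RingHom.ker (i.stalkMap c).hom

end

end SingularAlong

/-!
Write `f` for the dehomogenization of `F` on a chart `D₊(x_j)` and `I` for the ideal of `C` there.
The section `F` lies in `Γ(ℙⁿ, 𝓘²(l))` if and only if `f ∈ I ^ 2` on every chart, and `V(F)` is cut
out by `f` on the chart (`hypersurfaceIdeal_ideal_affineChart`), so that its local ring at a point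
`x` is `𝒪_x / (f)`, where `𝒪_x` is a Noetherian local domain with maximal ideal `𝔪_x`.

If `f ∈ I ^ 2`, then `f ∈ 𝔪_x ^ 2` for every point `x` of `C`, and the quotient of a Noetherian
local domain by a nonzero element of the square of the maximal ideal is not regular: its dimension
drops by one and its embedding dimension does not
(`not_isRegularLocalRing_of_surjective_of_ker_eq_span_singleton`).

Conversely, let `C` lie in the singular locus. At a generic point `x` of `C` the stalk of `I` is
`𝔪_x`, as `C` is reduced. It is generated by a regular sequence, so `𝒪_x` is regular, and since
`𝒪_x / (f)` is not, `f ∈ 𝔪_x ^ 2 = I_x ^ 2`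
(`IsRegularLocalRing.of_surjective_of_ker_eq_span_singleton`). At an arbitrary point `c` of `C` the
stalk `I_c` is a radical ideal generated by a regular sequence. Hence `I_c / I_c ^ 2` is free over
the reduced ring `𝒪_c / I_c`, and an element of it vanishes if it vanishes at the generic points
(`RingTheory.Sequence.IsWeaklyRegular.mem_sq_of_forall_minimalPrimes`). So `f ∈ I_c ^ 2` at all
points of `C`, and therefore `f ∈ I ^ 2`. Regularity of projective space itself is not needed.
-/

open IsLocalRing RingTheory.Sequence

/-! ### Ideals generated by regular sequences -/

/-- Elements of `J * (r 0, …, r (m - 1))` are combinations of the generators with coefficients in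
`J`. The coefficients form a function on `ℕ`, of which only the first `m` values matter. -/
theorem Ideal.exists_sum_eq_of_mem_mul_span {R : Type*} [CommRing R] {J : Ideal R} {r : ℕ → R}
    {m : ℕ} {x : R} (hx : x ∈ J * Ideal.span (r '' Set.Iio m)) :
    ∃ b : ℕ → R, (∀ i, b i ∈ J) ∧ ∑ i ∈ Finset.range m, b i * r i = x := by
  rw [show Set.Iio m = (Finset.range m : Set ℕ) by simp] at hx
  induction hx using Submodule.mul_induction_on' with
  | mem_mul_mem a ha y hy =>
    obtain ⟨d, rfl⟩ := (Submodule.mem_span_image_finset_iff_exists_fun' R).mp hy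
    exact ⟨fun i ↦ a * d i, fun i ↦ J.mul_mem_right _ ha, by
      simp only [mul_assoc, smul_eq_mul, Finset.mul_sum]⟩
  | add y _ z _ hy hz =>
    obtain ⟨b, hb, rfl⟩ := hy
    obtain ⟨c, hc, rfl⟩ := hz
    exact ⟨fun i ↦ b i + c i, fun i ↦ add_mem (hb i) (hc i), by
      simp only [add_mul, Finset.sum_add_distrib]⟩

/-- The coefficients of a linear relation among the members of a weakly regular sequence lie in
the ideal that the sequence generates. Regularity puts the last coefficient into the ideal of the
previous members, which turns the relation into one among these. -/
theorem coeff_mem_span_of_sum_eq_zero {R : Type*} [CommRing R] (r : ℕ → R) (m : ℕ)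
    (hr : ∀ i < m, ∀ a, a * r i ∈ Ideal.span (r '' Set.Iio i) → a ∈ Ideal.span (r '' Set.Iio i))
    (c : ℕ → R) (hc : ∑ i ∈ Finset.range m, c i * r i = 0) :
    ∀ i < m, c i ∈ Ideal.span (r '' Set.Iio m) := by
  induction m generalizing c with
  | zero => simp
  | succ m ih =>
    have hmono : Ideal.span (r '' Set.Iio m) ≤ Ideal.span (r '' Set.Iio (m + 1)) :=
      Ideal.span_mono (Set.image_mono (Set.Iio_subset_Iio (Nat.le_succ m)))
    have hrm : r m ∈ Ideal.span (r '' Set.Iio (m + 1)) :=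
      Ideal.subset_span ⟨m, Nat.lt_succ_self m, rfl⟩
    rw [Finset.sum_range_succ] at hc
    have hcm : c m ∈ Ideal.span (r '' Set.Iio m) := by
      refine hr m (Nat.lt_succ_self m) _ ?_
      rw [eq_neg_of_add_eq_zero_right hc]
      exact neg_mem (sum_mem fun i hi ↦ Ideal.mul_mem_left _ _
        (Ideal.subset_span ⟨i, Finset.mem_range.mp hi, rfl⟩))
    rw [← Ideal.top_mul (Ideal.span _)] at hcm
    obtain ⟨d, -, hd⟩ := Ideal.exists_sum_eq_of_mem_mul_span hcm
    rw [Ideal.top_mul] at hcm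
    have key := ih (fun i hi ↦ hr i (hi.trans (Nat.lt_succ_self m))) (fun i ↦ c i + d i * r m) (by
      rw [← hc, ← hd, Finset.sum_mul, ← Finset.sum_add_distrib]
      exact Finset.sum_congr rfl fun i _ ↦ by ring)
    intro i hi
    rcases Nat.lt_succ_iff_lt_or_eq.mp hi with hi | rfl
    · have := sub_mem (hmono (key i hi)) (Ideal.mul_mem_left _ (d i) hrm)
      simpa using this
    · exact hmono hcm

/-- A weakly regular list as a sequence indexed by `ℕ`, whose defining property is stated by
membership in ideals. -/
theorem RingTheory.Sequence.IsWeaklyRegular.exists_nat_sequence {R : Type*} [CommRing R]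
    {rs : List R} (h : IsWeaklyRegular R rs) :
    ∃ r : ℕ → R, Ideal.ofList rs = Ideal.span (r '' Set.Iio rs.length) ∧
      ∀ i < rs.length, ∀ a, a * r i ∈ Ideal.span (r '' Set.Iio i) →
        a ∈ Ideal.span (r '' Set.Iio i) := by
  have htake (i : ℕ) (hi : i ≤ rs.length) :
      Ideal.ofList (rs.take i) = Ideal.span ((fun j ↦ rs.getD j 0) '' Set.Iio i) := by
    refine congrArg Ideal.span (Set.ext fun x ↦ ?_)
    simp only [Set.mem_ofPred_eq, List.mem_take_iff_getElem, Set.mem_image, Set.mem_Iio]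
    constructor
    · rintro ⟨j, hj, rfl⟩
      exact ⟨j, by omega, by simp [show j < rs.length by omega]⟩
    · rintro ⟨j, hj, rfl⟩
      exact ⟨j, by omega, by simp [show j < rs.length by omega]⟩
  refine ⟨fun j ↦ rs.getD j 0, by simpa using htake _ le_rfl, fun i hi a ha ↦ ?_⟩
  rw [← htake i hi.le] at ha ⊢
  have hreg := (isWeaklyRegular_iff_Fin R rs).mp h ⟨i, hi⟩
  rw [isSMulRegular_quotient_iff_mem_of_smul_mem] at hreg
  have := hreg a
  simp only [smul_eq_mul, Ideal.mul_top] at this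
  refine this ?_
  rw [mul_comm]
  simpa [hi] using ha

/-- If a radical ideal `I` is generated by a weakly regular sequence, membership in `I ^ 2` can be
tested at the minimal primes of `I`: the coefficients of `f` with respect to the sequence are
determined modulo `I`, and they vanish modulo every minimal prime of the radical ideal `I`. -/
theorem RingTheory.Sequence.IsWeaklyRegular.mem_sq_of_forall_minimalPrimes {R : Type*} [CommRing R]
    {rs : List R} (h : IsWeaklyRegular R rs) (hrad : (Ideal.ofList rs).IsRadical) {f : R}
    (hf : ∀ q ∈ (Ideal.ofList rs).minimalPrimes, ∃ s ∉ q, s * f ∈ Ideal.ofList rs ^ 2) :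
    f ∈ Ideal.ofList rs ^ 2 := by
  obtain ⟨r, hr, hreg⟩ := h.exists_nat_sequence
  -- A radical ideal is the intersection of its minimal primes.
  have mem_of (a : R) (ha : ∀ q ∈ (Ideal.ofList rs).minimalPrimes, a ∈ q) :
      a ∈ Ideal.ofList rs := by
    rw [← hrad.radical, ← Ideal.sInf_minimalPrimes]
    exact Submodule.mem_sInf.mpr ha
  generalize Ideal.ofList rs = I at *
  have hrI (i : ℕ) (hi : i < rs.length) : r i ∈ I := hr ▸ Ideal.subset_span ⟨i, hi, rfl⟩
  obtain ⟨c, hc⟩ : ∃ c : ℕ → R, ∑ i ∈ Finset.range rs.length, c i * r i = f := by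
    have hfI : f ∈ I := mem_of f fun q hq ↦ by
      obtain ⟨s, hs, hsf⟩ := hf q hq
      exact (hq.1.1.mem_or_mem (hq.1.2 (Ideal.pow_le_self two_ne_zero hsf))).resolve_left hs
    rw [hr, ← Ideal.top_mul (Ideal.span _)] at hfI
    obtain ⟨c, -, hc⟩ := Ideal.exists_sum_eq_of_mem_mul_span hfI
    exact ⟨c, hc⟩
  have hcI (i : ℕ) (hi : i < rs.length) : c i ∈ I := mem_of _ fun q hq ↦ by
    obtain ⟨s, hs, hsf⟩ := hf q hq
    -- Two expansions of `s * f`: by hypothesis with coefficients `b i` in `I`, and with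
    -- coefficients `s * c i`. They agree modulo `I`.
    obtain ⟨b, hbI, hb⟩ : ∃ b : ℕ → R, (∀ i, b i ∈ I) ∧
        ∑ i ∈ Finset.range rs.length, b i * r i = s * f := by
      rw [pow_two] at hsf
      nth_rw 2 [hr] at hsf
      exact Ideal.exists_sum_eq_of_mem_mul_span hsf
    have h0 := coeff_mem_span_of_sum_eq_zero r _ hreg (fun i ↦ s * c i - b i) (by
      simp only [sub_mul, Finset.sum_sub_distrib, hb, mul_assoc, ← Finset.mul_sum, hc, sub_self])
      i hi
    rw [← hr] at h0
    have h1 : s * c i ∈ I := by simpa using add_mem h0 (hbI i)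
    exact (hq.1.1.mem_or_mem (hq.1.2 h1)).resolve_left hs
  rw [← hc, pow_two]
  exact sum_mem fun i hi ↦ Ideal.mul_mem_mul (hcI i (Finset.mem_range.mp hi))
    (hrI i (Finset.mem_range.mp hi))

/-! ### Regularity of hypersurface local rings -/

/-- A Noetherian local ring is regular if a regular sequence generates its maximal ideal: the
length of the sequence is then the dimension of the ring. -/
theorem IsRegularLocalRing.of_isRegular_of_ofList_eq {A : Type*} [CommRing A] [IsLocalRing A]
    [IsNoetherianRing A] {rs : List A} (h : IsRegular A rs)
    (hrs : Ideal.ofList rs = maximalIdeal A) : IsRegularLocalRing A := by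
  classical
  refine .of_spanFinrank_maximalIdeal_le _ ?_
  rw [← ringKrullDim_add_length_eq_ringKrullDim_of_isRegular rs h, hrs,
    ringKrullDim_eq_zero_of_isField ((Ideal.Quotient.maximal_ideal_iff_isField_quotient _).mp
      inferInstance), zero_add, ← hrs]
  have : {r | r ∈ rs} = (rs.toFinset : Set A) := by ext; simp
  rw [Ideal.ofList, this]
  have h1 := Submodule.spanFinrank_span_le_ncard_of_finite (R := A) rs.toFinset.finite_toSet
  rw [Set.ncard_coe_finset] at h1
  exact_mod_cast h1.trans rs.toFinset_card_le

/-- A regular local ring stays regular modulo an element of `𝔪 \ 𝔪 ^ 2`: such an element can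
replace a member of a minimal generating set of `𝔪`, and the dimension drops by at most one. -/
theorem IsRegularLocalRing.of_surjective_of_ker_eq_span_singleton {A B : Type*} [CommRing A]
    [CommRing B] [IsRegularLocalRing A] [IsLocalRing B] {φ : A →+* B}
    (hφ : Function.Surjective φ) {f : A} (hker : RingHom.ker φ = Ideal.span {f})
    (hf : f ∈ maximalIdeal A) (hf2 : f ∉ maximalIdeal A ^ 2) : IsRegularLocalRing B := by
  classical
  have : IsNoetherianRing B := isNoetherianRing_of_surjective A B φ hφ
  have := IsLocalHom.of_surjective φ hφ
  have hmB : maximalIdeal B = (maximalIdeal A).map φ := by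
    rw [← maximalIdeal_comap φ, Ideal.map_comap_of_surjective φ hφ]
  obtain ⟨T, hTcard, hT⟩ := Submodule.FG.exists_span_finset_card_eq_spanFinrank
    (IsNoetherian.noetherian (maximalIdeal A))
  obtain ⟨c, hc⟩ : ∃ c : A → A, ∑ t ∈ T, c t * t = f := by
    rw [← hT] at hf
    obtain ⟨c, -, hc⟩ := Submodule.mem_span_finset.mp hf
    exact ⟨c, hc⟩
  have hTm (t : A) (ht : t ∈ T) : t ∈ maximalIdeal A := hT ▸ Submodule.subset_span ht
  obtain ⟨t, ht, hct⟩ : ∃ t ∈ T, IsUnit (c t) := by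
    by_contra! H
    refine hf2 ?_
    rw [← hc, pow_two]
    exact sum_mem fun t ht ↦ Ideal.mul_mem_mul ((mem_maximalIdeal _).mpr (H t ht)) (hTm t ht)
  have hspan : maximalIdeal B = Ideal.span ((T.erase t).image φ : Set B) := by
    apply le_antisymm
    · -- Since `φ f = 0` and `c t` is a unit, the image of `t` is redundant.
      have hmem (a : A) (ha : a ∈ T.erase t) :
          φ a ∈ Ideal.span ((T.erase t).image φ : Set B) :=
        Ideal.subset_span (Finset.mem_image_of_mem φ ha)
      have hφf : φ f = 0 := by
        rw [← RingHom.mem_ker, hker]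
        exact Ideal.mem_span_singleton_self f
      rw [hmB, ← hT, Ideal.map_le_iff_le_comap]
      refine Submodule.span_le.mpr fun a ha ↦ ?_
      rw [SetLike.mem_coe, Ideal.mem_comap]
      by_cases hat : a = t
      · subst hat
        rw [← hc, ← Finset.add_sum_erase T _ ht, map_add, map_mul, map_sum] at hφf
        rw [← Ideal.unit_mul_mem_iff_mem _ (hct.map φ), eq_neg_of_add_eq_zero_left hφf]
        exact neg_mem (sum_mem fun b hb ↦ by
          rw [map_mul]
          exact Ideal.mul_mem_left _ _ (hmem b hb))
      · exact hmem a (Finset.mem_erase.mpr ⟨hat, ha⟩)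
    · rw [Ideal.span_le]
      intro b hb
      obtain ⟨a, ha, rfl⟩ := Finset.mem_image.mp hb
      exact hmB ▸ Ideal.mem_map_of_mem φ (hTm a (Finset.mem_of_mem_erase ha))
  refine .of_spanFinrank_maximalIdeal_le _ ?_
  -- Generator count: the images of `T` without `t` suffice for the maximal ideal of `B`.
  have hle : (maximalIdeal B).spanFinrank + 1 ≤ (maximalIdeal A).spanFinrank := by
    have h1 := Submodule.spanFinrank_span_le_ncard_of_finite (R := B)
      ((T.erase t).image φ).finite_toSet
    rw [Set.ncard_coe_finset] at h1
    rw [hspan, ← hTcard, ← Finset.card_erase_add_one ht]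
    exact Nat.add_le_add_right (h1.trans Finset.card_image_le) 1
  have hdim : ringKrullDim A ≤ ringKrullDim B + 1 := by
    have := ringKrullDim_le_ringKrullDim_quotient_add_card {f} (by
      simpa [IsLocalRing.ringJacobson_eq_maximalIdeal] using hf)
    rw [Finset.coe_singleton, ← hker, ringKrullDim_eq_of_ringEquiv
      (RingHom.quotientKerEquivOfSurjective hφ)] at this
    simpa using this
  rw [← IsRegularLocalRing.spanFinrank_maximalIdeal (R := A)] at hdim
  have := (Nat.cast_le (α := WithBot ℕ∞).mpr hle).trans hdim
  push_cast at this
  exact (ENat.WithBot.add_le_add_one_right_iff).mp this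

/-- A Noetherian local domain modulo a nonzero element of `𝔪 ^ 2` is never regular: by Nakayama's
lemma `𝔪` needs as many generators as its image, while the dimension drops by one. -/
theorem not_isRegularLocalRing_of_surjective_of_ker_eq_span_singleton {A B : Type*} [CommRing A]
    [CommRing B] [IsLocalRing A] [IsNoetherianRing A] [IsDomain A] {φ : A →+* B}
    (hφ : Function.Surjective φ) {f : A} (hker : RingHom.ker φ = Ideal.span {f})
    (hf0 : f ≠ 0) (hf2 : f ∈ maximalIdeal A ^ 2) : ¬ IsRegularLocalRing B := by
  classical
  intro hB
  have hf : f ∈ maximalIdeal A := Ideal.pow_le_self two_ne_zero hf2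
  have hdim : ringKrullDim B + 1 = ringKrullDim A := by
    rw [← ringKrullDim_quotient_span_singleton_succ_eq_ringKrullDim_of_mem_nonZeroDivisors
      (mem_nonZeroDivisors_of_ne_zero hf0) hf, ← hker, ringKrullDim_eq_of_ringEquiv
      (RingHom.quotientKerEquivOfSurjective hφ)]
  obtain ⟨T, hTcard, hT⟩ := Submodule.FG.exists_span_finset_card_eq_spanFinrank
    (IsNoetherian.noetherian (maximalIdeal B))
  -- Lifts of generators of the maximal ideal of `B` generate that of `A` together with `f`, and
  -- `f` is redundant because it lies in the square.
  let g := Function.surjInv hφ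
  have hg : ∀ b, φ (g b) = b := Function.surjInv_eq hφ
  have := IsLocalHom.of_surjective φ hφ
  have hmB (a : A) : φ a ∈ maximalIdeal B ↔ a ∈ maximalIdeal A := by
    rw [← maximalIdeal_comap φ, Ideal.mem_comap]
  have hspan : maximalIdeal A ≤ Ideal.span (T.image g : Set A) := by
    refine Submodule.le_of_le_smul_of_le_jacobson_bot (I := maximalIdeal A)
      (IsNoetherian.noetherian _) (maximalIdeal_le_jacobson _) ?_
    have h1 : maximalIdeal A ≤ Ideal.span (T.image g : Set A) ⊔ Ideal.span {f} := by
      intro a ha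
      have hgT : maximalIdeal B ≤ (Ideal.span (T.image g : Set A)).map φ := by
        rw [← hT]
        refine Submodule.span_le.mpr fun b hb ↦ ?_
        rw [← hg b]
        exact Ideal.mem_map_of_mem φ (Ideal.subset_span (Finset.mem_image_of_mem g hb))
      obtain ⟨a', ha', haa'⟩ := (Ideal.mem_map_iff_of_surjective φ hφ).mp
        (hgT ((hmB a).mpr ha))
      rw [← add_sub_cancel a' a]
      refine add_mem (Ideal.mem_sup_left ha') (Ideal.mem_sup_right ?_)
      rw [← hker, RingHom.mem_ker, map_sub, haa', sub_self]
    refine h1.trans (sup_le_sup_left ?_ _)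
    rw [smul_eq_mul, ← pow_two]
    simpa using hf2
  have hle : (maximalIdeal A).spanFinrank ≤ (maximalIdeal B).spanFinrank := by
    have heq : maximalIdeal A = Ideal.span (T.image g : Set A) := by
      refine hspan.antisymm ?_
      rw [Ideal.span_le]
      intro a ha
      obtain ⟨b, hb, rfl⟩ := Finset.mem_image.mp ha
      rw [SetLike.mem_coe, ← hmB, hg, ← hT]
      exact Submodule.subset_span hb
    have h1 := Submodule.spanFinrank_span_le_ncard_of_finite (R := A) (T.image g).finite_toSet
    rw [Set.ncard_coe_finset] at h1
    rw [heq, ← hTcard]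
    exact h1.trans Finset.card_image_le
  have h2 := ringKrullDim_le_spanFinrank_maximalIdeal A
  rw [← hdim, ← hB.spanFinrank_maximalIdeal] at h2
  have h3 : (maximalIdeal B).spanFinrank + 1 ≤ (maximalIdeal A).spanFinrank := by exact_mod_cast h2
  omega

/-! ### Stalks of closed immersions -/

/-- The kernel of a closed immersion on stalks is the extension of the ideal of the closed
subscheme on any affine open neighbourhood. If a section `a` dies in the stalk of `Z`, it is killed
in `Γ(Z, i ⁻¹ᵁ U)` by a function invertible at `z`, which lifts to a function on `U`. -/
theorem AlgebraicGeometry.IsClosedImmersion.ker_stalkMap {Z X : Scheme.{u}} (i : Z ⟶ X)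
    [IsClosedImmersion i] (U : X.affineOpens) (z : Z) (hz : i z ∈ U.1) :
    RingHom.ker (i.stalkMap z).hom =
      (i.ker.ideal U).map (X.presheaf.germ U.1 (i z) hz).hom := by
  have hV : IsAffineOpen (i ⁻¹ᵁ U.1) := U.2.preimage i
  let zV : (i ⁻¹ᵁ U.1 : Z.Opens) := ⟨z, hz⟩
  let xU : U.1 := ⟨i z, hz⟩
  let : Algebra Γ(X, U.1) (X.presheaf.stalk (i z)) := X.presheaf.algebra_section_stalk xU
  let : Algebra Γ(Z, i ⁻¹ᵁ U.1) (Z.presheaf.stalk z) := Z.presheaf.algebra_section_stalk zV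
  have hlX : IsLocalization.AtPrime (X.presheaf.stalk (i z)) (U.2.primeIdealOf xU).asIdeal :=
    U.2.isLocalization_stalk xU
  have hlZ : IsLocalization.AtPrime (Z.presheaf.stalk z) (hV.primeIdealOf zV).asIdeal :=
    hV.isLocalization_stalk zV
  have hgerm (a : Γ(X, U.1)) : (i.stalkMap z).hom (algebraMap _ _ a) =
      algebraMap Γ(Z, i ⁻¹ᵁ U.1) (Z.presheaf.stalk z) ((i.app U.1).hom a) :=
    i.germ_stalkMap_apply U.1 z hz a
  change _ = (i.ker.ideal U).map (algebraMap Γ(X, U.1) (X.presheaf.stalk (i z)))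
  rw [Scheme.Hom.ker_apply]
  apply le_antisymm
  · intro y hy
    obtain ⟨a, s, rfl⟩ := IsLocalization.exists_mk'_eq (U.2.primeIdealOf xU).asIdeal.primeCompl y
    have ha : (i.stalkMap z).hom (algebraMap _ _ a) = 0 := by
      rw [← IsLocalization.mk'_spec' (X.presheaf.stalk (i z)) a s, map_mul, RingHom.mem_ker.mp hy,
        mul_zero]
    rw [hgerm, IsLocalization.map_eq_zero_iff (hV.primeIdealOf zV).asIdeal.primeCompl] at ha
    obtain ⟨⟨t, ht⟩, hta⟩ := ha
    obtain ⟨t, rfl⟩ := i.app_surjective U.1 U.2 t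
    have hunit : IsUnit (algebraMap Γ(X, U.1) (X.presheaf.stalk (i z)) t) := by
      apply isUnit_of_map_unit (i.stalkMap z).hom
      rw [hgerm]
      exact IsLocalization.map_units (Z.presheaf.stalk z) (⟨_, ht⟩ : Ideal.primeCompl _)
    rw [IsLocalization.mk'_mem_iff, ← Ideal.unit_mul_mem_iff_mem _ hunit, ← map_mul]
    refine Ideal.mem_map_of_mem _ ?_
    rw [RingHom.mem_ker, map_mul]
    exact hta
  · rw [Ideal.map_le_iff_le_comap]
    intro a ha
    rw [Ideal.mem_comap, RingHom.mem_ker, hgerm, RingHom.mem_ker.mp ha, map_zero]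

/-! ### Charts of projective space and the ideal of a hypersurface -/

theorem AlgebraicGeometry.Scheme.Hom.comp_appLE_top {X Y Z : Scheme.{u}} (f : X ⟶ Y) (g : Y ⟶ Z)
    (U : Z.Opens) (h : ⊤ ≤ (f ≫ g) ⁻¹ᵁ U) (h' : ⊤ ≤ g ⁻¹ᵁ U) :
    (f ≫ g).appLE U ⊤ h = g.appLE U ⊤ h' ≫ f.appTop :=
  (Scheme.Hom.appLE_comp_appLE f g U ⊤ ⊤ h' le_rfl).symm.trans
    (congrArg (g.appLE U ⊤ h' ≫ ·) (Scheme.Hom.appLE_eq_app f (U := ⊤)))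

/-- Elements of `A_(f)`, regarded as functions on `D₊(f)`, pull back along the chart
`Spec A_(f) ⟶ Proj A` to themselves. -/
theorem AlgebraicGeometry.Proj.awayToSection_appLE_awayι {σ : Type*} {A : Type u} [CommRing A]
    [SetLike σ A] [AddSubgroupClass σ A] (𝒜 : ℕ → σ) [GradedRing 𝒜] {f : A} {m : ℕ}
    (f_deg : f ∈ 𝒜 m) (hm : 0 < m) (h : ⊤ ≤ awayι 𝒜 f f_deg hm ⁻¹ᵁ basicOpen 𝒜 f) :
    awayToSection 𝒜 f ≫ (awayι 𝒜 f f_deg hm).appLE (basicOpen 𝒜 f) ⊤ h =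
      (Scheme.ΓSpecIso (.of (HomogeneousLocalization.Away 𝒜 f))).inv := by
  have hι : (basicOpen 𝒜 f).ι.appLE (basicOpen 𝒜 f) ⊤ (by simp) =
      (basicOpen 𝒜 f).topIso.inv := by
    rw [Scheme.Opens.ι_appLE, Scheme.Opens.topIso_inv]
    rfl
  have happ : (awayι 𝒜 f f_deg hm).appLE (basicOpen 𝒜 f) ⊤ h =
      (basicOpen 𝒜 f).topIso.inv ≫ (basicOpenIsoSpec 𝒜 f f_deg hm).inv.appTop := by
    rw [← hι]
    exact Scheme.Hom.comp_appLE_top _ _ _ _ _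
  have htop : awayToSection 𝒜 f ≫ (basicOpen 𝒜 f).topIso.inv =
      (Scheme.ΓSpecIso _).inv ≫ (basicOpenIsoSpec 𝒜 f f_deg hm).hom.appTop := by
    rw [basicOpenIsoSpec_hom, Scheme.Hom.appTop, basicOpenToSpec_app_top, Iso.inv_hom_id_assoc]
  rw [happ, reassoc_of% htop, ← Scheme.Hom.comp_appTop, Iso.inv_hom_id, Scheme.Hom.id_appTop,
    Category.comp_id]

namespace SingularAlong

variable {k : Type u} [Field k] {n : ℕ}

instance (i : Fin (n + 1)) : IsDomain (ChartRing k i) := by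
  have : IsDomain (Localization.Away (MvPolynomial.X i : MvPolynomial (Fin (n + 1)) k)) :=
    IsLocalization.isDomain_localization
      (powers_le_nonZeroDivisors_of_noZeroDivisors (MvPolynomial.X_ne_zero i))
  exact (HomogeneousLocalization.val_injective _).isDomain
    (algebraMap (ChartRing k i) (Localization.Away (MvPolynomial.X i)))

instance (i : Fin (n + 1)) : IsNoetherianRing (ChartRing k i) := by
  -- The degree zero part of the polynomial ring consists of constants.
  have : IsNoetherianRing (grading k n 0) := by
    refine isNoetherianRing_of_surjective k _ (algebraMap k (grading k n 0)) fun p ↦ ?_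
    have hp : p.1.totalDegree = 0 := by
      by_cases h : p.1 = 0
      · simp [h]
      · exact MvPolynomial.IsHomogeneous.totalDegree p.2 h
    exact ⟨_, Subtype.ext (MvPolynomial.totalDegree_eq_zero_iff_eq_C.mp hp).symm⟩
  have : Algebra.FiniteType (grading k n 0) (MvPolynomial (Fin (n + 1)) k) :=
    have : IsScalarTower k (grading k n 0) (MvPolynomial (Fin (n + 1)) k) :=
      IsScalarTower.of_algebraMap_eq (R := k) (S := grading k n 0)
        (A := MvPolynomial (Fin (n + 1)) k) fun _ ↦ rfl
    .of_restrictScalars_finiteType k _ _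
  have := HomogeneousLocalization.Away.finiteType (𝒜 := grading k n) (MvPolynomial.X i) 1
    (X_mem_grading i)
  exact Algebra.FiniteType.isNoetherianRing (grading k n 0) _

theorem dehomogenize_ne_zero {l : ℕ} {F : MvPolynomial (Fin (n + 1)) k} (hF : F.IsHomogeneous l)
    (hF0 : F ≠ 0) (i : Fin (n + 1)) : dehomogenize F hF i ≠ 0 := by
  intro h
  have := congrArg HomogeneousLocalization.val h
  rw [dehomogenize, HomogeneousLocalization.Away.val_mk, HomogeneousLocalization.val_zero,
    Localization.mk_eq_mk', IsLocalization.mk'_eq_zero_iff] at this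
  obtain ⟨⟨_, m, rfl⟩, hm⟩ := this
  simp [hF0] at hm

/-- The coordinate ring of a chart as the ring of regular functions on the chart. -/
noncomputable def chartRingEquiv (k : Type u) [Field k] {n : ℕ} (i : Fin (n + 1)) :
    ChartRing k i ≃+* Γ(PSpace k n, chart k i) :=
  (Proj.basicOpenIsoAway (grading k n) (MvPolynomial.X i)
    (X_mem_grading i) one_pos).commRingCatIsoToRingEquiv

theorem chartRingEquiv_dehomogenize {l : ℕ} (F : MvPolynomial (Fin (n + 1)) k)
    (hF : F.IsHomogeneous l) (i : Fin (n + 1)) :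
    chartRingEquiv k i (dehomogenize F hF i) = localSection F hF i := rfl

instance (i : Fin (n + 1)) : IsDomain Γ(PSpace k n, chart k i) :=
  (chartRingEquiv k i).toMulEquiv.isDomain_iff.mp inferInstance

instance (i : Fin (n + 1)) : IsNoetherianRing Γ(PSpace k n, chart k i) :=
  isNoetherianRing_of_ringEquiv _ (chartRingEquiv k i)

theorem localSection_ne_zero {l : ℕ} {F : MvPolynomial (Fin (n + 1)) k} (hF : F.IsHomogeneous l)
    (hF0 : F ≠ 0) (i : Fin (n + 1)) : localSection F hF i ≠ 0 := by
  rw [← chartRingEquiv_dehomogenize]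
  exact (map_ne_zero_iff _ (chartRingEquiv k i).injective).mpr (dehomogenize_ne_zero hF hF0 i)

theorem top_le_chartι_preimage (i : Fin (n + 1)) : ⊤ ≤ chartι k i ⁻¹ᵁ chart k i := by
  rw [chart, chartι, ← Proj.opensRange_awayι (grading k n) (MvPolynomial.X i) (X_mem_grading i)
    one_pos, Scheme.Hom.preimage_opensRange]

theorem appLE_chartι_chartRingEquiv (i : Fin (n + 1)) (a : ChartRing k i) :
    ((chartι k i).appLE (chart k i) ⊤ (top_le_chartι_preimage i)).hom (chartRingEquiv k i a) =
      (Scheme.ΓSpecIso (.of (ChartRing k i))).inv.hom a :=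
  congr($(Proj.awayToSection_appLE_awayι (grading k n) (X_mem_grading i) one_pos _).hom a)

section
variable {l : ℕ} (F : MvPolynomial (Fin (n + 1)) k) (hF : F.IsHomogeneous l)

/-- The affine hypersurface cut out by `F / x_i ^ l` in the chart `D₊(x_i)`, mapped to projective
space. -/
noncomputable def chartHypersurfaceι (i : Fin (n + 1)) :
    Spec (.of (ChartRing k i ⧸ Ideal.span {dehomogenize F hF i})) ⟶ PSpace k n :=
  Spec.map (CommRingCat.ofHom
    (Ideal.Quotient.mk (Ideal.span {dehomogenize F hF i}))) ≫ chartι k i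

theorem top_le_chartHypersurfaceι_preimage (i : Fin (n + 1)) :
    ⊤ ≤ chartHypersurfaceι F hF i ⁻¹ᵁ chart k i := by
  rw [chartHypersurfaceι, Scheme.Hom.comp_preimage, top_le_iff.mp (top_le_chartι_preimage i)]
  simp

theorem appLE_chartHypersurfaceι_eq_zero_iff (i : Fin (n + 1)) (s : Γ(PSpace k n, chart k i)) :
    ((chartHypersurfaceι F hF i).appLE (chart k i) ⊤
      (top_le_chartHypersurfaceι_preimage F hF i)).hom s = 0 ↔
        s ∈ Ideal.span {localSection F hF i} := by
  obtain ⟨a, rfl⟩ := (chartRingEquiv k i).surjective s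
  have happ : (chartHypersurfaceι F hF i).appLE (chart k i) ⊤
      (top_le_chartHypersurfaceι_preimage F hF i) =
      (chartι k i).appLE (chart k i) ⊤ (top_le_chartι_preimage i) ≫
        (Spec.map (CommRingCat.ofHom
          (Ideal.Quotient.mk (Ideal.span {dehomogenize F hF i})))).appTop :=
    Scheme.Hom.comp_appLE_top _ _ _ _ _
  have hnat := congr($(Scheme.ΓSpecIso_inv_naturality (CommRingCat.ofHom
    (Ideal.Quotient.mk (Ideal.span {dehomogenize F hF i})))).hom a)
  rw [happ, CommRingCat.hom_comp, RingHom.comp_apply, appLE_chartι_chartRingEquiv]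
  rw [CommRingCat.hom_comp, RingHom.comp_apply, CommRingCat.hom_comp, RingHom.comp_apply] at hnat
  rw [← hnat, map_eq_zero_iff (Scheme.ΓSpecIso _).inv.hom
      (Scheme.ΓSpecIso _).symm.commRingCatIsoToRingEquiv.injective, CommRingCat.hom_ofHom,
    Ideal.Quotient.eq_zero_iff_mem, ← chartRingEquiv_dehomogenize,
    Ideal.mem_span_singleton, Ideal.mem_span_singleton, map_dvd_iff]

/-- On each chart the hypersurface `V(F)` is cut out by the dehomogenization of `F`. The infimum
defining its ideal sheaf is attained at the chart itself, since on the intersection with another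
chart the two dehomogenizations differ by a factor `(x_i / x_j) ^ l`. -/
theorem hypersurfaceIdeal_ideal_affineChart (j : Fin (n + 1)) :
    (hypersurfaceIdeal F hF).ideal (affineChart k j) = Ideal.span {localSection F hF j} := by
  change (⨅ i, (chartHypersurfaceι F hF i).ker : (PSpace k n).IdealSheafData).ideal _ = _
  rw [Scheme.IdealSheafData.ideal_iInf, iInf_apply]
  simp only [Scheme.Hom.ker_apply]
  change ⨅ i, RingHom.ker ((chartHypersurfaceι F hF i).app (chart k j)).hom = _
  apply le_antisymm
  · refine (iInf_le _ j).trans fun s hs ↦ ?_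
    rw [RingHom.mem_ker] at hs
    rw [← appLE_chartHypersurfaceι_eq_zero_iff, Scheme.Hom.appLE, CommRingCat.hom_comp,
      RingHom.comp_apply, hs, map_zero]
  · refine le_iInf fun i ↦ ?_
    rw [Ideal.span_singleton_le_iff_mem, RingHom.mem_ker]
    let g := chartHypersurfaceι F hF i
    have h0 := (appLE_chartHypersurfaceι_eq_zero_iff F hF i _).mpr
      (Ideal.mem_span_singleton_self (localSection F hF i))
    have hi : g ⁻¹ᵁ chart k j ≤ g ⁻¹ᵁ chart k i :=
      le_top.trans (top_le_chartHypersurfaceι_preimage F hF i)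
    have hij : g ⁻¹ᵁ chart k j ≤ g ⁻¹ᵁ (chart k j ⊓ chart k i) := le_inf le_rfl hi
    have hglue := congrArg (g.appLE (chart k j ⊓ chart k i) (g ⁻¹ᵁ chart k j) hij).hom
      ((formSection F hF).2.2 j i)
    have hj' (s) : (g.appLE (chart k j ⊓ chart k i) (g ⁻¹ᵁ chart k j) hij).hom
        (restr inf_le_left s) = (g.app (chart k j)).hom s := by
      rw [Scheme.Hom.app_eq_appLE, ← Scheme.Hom.map_appLE _ hij (homOfLE inf_le_left).op]
      rfl
    -- The hypersurface in the chart `i` lies over that chart, so restricting to the intersection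
    -- of the charts `i` and `j` before pulling back loses nothing.
    have hi' (s) : (g.appLE (chart k j ⊓ chart k i) (g ⁻¹ᵁ chart k j) hij).hom
        (restr inf_le_right s) = ((Spec _).presheaf.map (homOfLE le_top).op).hom
          ((g.appLE (chart k i) ⊤ (top_le_chartHypersurfaceι_preimage F hF i)).hom s) := by
      have h1 := congr($(g.map_appLE hij (homOfLE inf_le_right).op).hom s)
      have h2 := congr($(g.appLE_map (top_le_chartHypersurfaceι_preimage F hF i)
        (homOfLE le_top : g ⁻¹ᵁ chart k j ⟶ ⊤).op).hom s)
      exact h1.trans h2.symm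
    rw [hj', map_mul, hi'] at hglue
    refine hglue.trans ?_
    erw [h0]
    rw [map_zero, mul_zero]

end

end SingularAlong

/-! ### Testing membership in the square of an ideal locally -/

theorem IsLocalization.AtPrime.algebraMap_mem_map_iff {R S : Type*} [CommRing R] [CommRing S]
    [Algebra R S] (p : Ideal R) [p.IsPrime] [IsLocalization.AtPrime S p] {J : Ideal R} {f : R} :
    algebraMap R S f ∈ J.map (algebraMap R S) ↔ ∃ s ∉ p, s * f ∈ J := by
  rw [IsLocalization.algebraMap_mem_map_algebraMap_iff p.primeCompl]
  rfl

/-- If the radical extension of `I` to the localization at `p` is generated by a weakly regular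
sequence, then membership in `I ^ 2` locally at `p` can be tested at the minimal primes of `I`. -/
theorem IsLocalization.AtPrime.exists_mul_mem_sq {R S : Type*} [CommRing R] [CommRing S]
    [Algebra R S] (p : Ideal R) [p.IsPrime] [IsLocalization.AtPrime S p] {I : Ideal R} {f : R}
    {rs : List S} (h : IsWeaklyRegular S rs) (hrs : Ideal.ofList rs = I.map (algebraMap R S))
    (hrad : (I.map (algebraMap R S)).IsRadical)
    (hf : ∀ q ∈ I.minimalPrimes, ∃ s ∉ q, s * f ∈ I ^ 2) : ∃ s ∉ p, s * f ∈ I ^ 2 := by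
  rw [← algebraMap_mem_map_iff (S := S), Ideal.map_pow, ← hrs]
  refine h.mem_sq_of_forall_minimalPrimes (hrs ▸ hrad) fun q hq ↦ ?_
  rw [hrs, IsLocalization.minimalPrimes_map p.primeCompl] at hq
  obtain ⟨s, hs, hsf⟩ := hf _ hq
  refine ⟨algebraMap R S s, hs, ?_⟩
  rw [hrs, ← Ideal.map_pow, ← map_mul]
  exact Ideal.mem_map_of_mem _ hsf

theorem Ideal.mem_sq_of_forall_prime {R : Type*} [CommRing R] {I : Ideal R} {f : R}
    (h : ∀ p : Ideal R, p.IsPrime → I ≤ p → ∃ s ∉ p, s * f ∈ I ^ 2) : f ∈ I ^ 2 := by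
  by_contra hf
  let J : Ideal R := Submodule.comap (LinearMap.mulRight R f) (I ^ 2)
  have hJ (s : R) : s ∈ J ↔ s * f ∈ I ^ 2 := Iff.rfl
  obtain ⟨p, hp, hJp⟩ := J.exists_le_maximal (by
    rw [Ideal.ne_top_iff_one, hJ, one_mul]
    exact hf)
  obtain ⟨s, hs, hsf⟩ := h p hp.isPrime (by
    intro s hs
    -- An element `s` of `I` has `s ^ 2 * f ∈ I ^ 2`, so `p` contains `I`.
    refine hp.isPrime.mem_of_pow_mem 2 (hJp ((hJ _).mpr ?_))
    exact Ideal.mul_mem_right _ _ (Ideal.pow_mem_pow hs 2))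
  exact hs (hJp hsf)

/-! ### Local rings of projective space, of the hypersurface and of `C` -/

namespace SingularAlong

variable {k : Type u} [Field k] {n : ℕ}

theorem exists_mem_chart (x : PSpace k n) : ∃ j, x ∈ chart k j := by
  have h : ⨆ j : Fin (n + 1), chart k j = ⊤ := by
    refine Proj.iSup_basicOpen_eq_top' (grading k n) MvPolynomial.X
      (fun j ↦ ⟨1, X_mem_grading j⟩) (top_le_iff.mp fun p _ ↦ ?_)
    induction p using MvPolynomial.induction_on with
    | C a => exact Subalgebra.algebraMap_mem _ (algebraMap k (grading k n 0) a)
    | add p q hp hq => exact add_mem (hp trivial) (hq trivial)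
    | mul_X p j hp => exact mul_mem (hp trivial) (Algebra.subset_adjoin ⟨j, rfl⟩)
  simpa using h.ge (Set.mem_univ x)

theorem isAffineOpen_chart (j : Fin (n + 1)) : IsAffineOpen (chart k j) := (affineChart k j).2

/-- The prime ideal of functions on a chart that vanish at a given point of the chart. -/
noncomputable def chartPrime {j : Fin (n + 1)} {x : PSpace k n} (hx : x ∈ chart k j) :
    Ideal Γ(PSpace k n, chart k j) :=
  ((isAffineOpen_chart j).primeIdealOf ⟨x, hx⟩).asIdeal

instance {j : Fin (n + 1)} {x : PSpace k n} (hx : x ∈ chart k j) : (chartPrime hx).IsPrime :=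
  ((isAffineOpen_chart j).primeIdealOf ⟨x, hx⟩).isPrime

/-- The ring of functions on a chart acts on the stalks at its points. -/
noncomputable abbrev chartStalkAlgebra {j : Fin (n + 1)} {x : PSpace k n} (hx : x ∈ chart k j) :
    Algebra Γ(PSpace k n, chart k j) ((PSpace k n).presheaf.stalk x) :=
  ((PSpace k n).presheaf.germ (chart k j) x hx).hom.toAlgebra

theorem isLocalization_stalk {j : Fin (n + 1)} {x : PSpace k n} (hx : x ∈ chart k j) :
    letI := chartStalkAlgebra hx
    IsLocalization.AtPrime ((PSpace k n).presheaf.stalk x) (chartPrime hx) :=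
  (isAffineOpen_chart j).isLocalization_stalk ⟨x, hx⟩

instance (x : PSpace k n) : IsDomain ((PSpace k n).presheaf.stalk x) := by
  obtain ⟨j, hx⟩ := exists_mem_chart x
  let := chartStalkAlgebra hx
  have := isLocalization_stalk hx
  exact IsLocalization.isDomain_of_le_nonZeroDivisors _
    (chartPrime hx).primeCompl_le_nonZeroDivisors

instance (x : PSpace k n) : IsNoetherianRing ((PSpace k n).presheaf.stalk x) := by
  obtain ⟨j, hx⟩ := exists_mem_chart x
  let := chartStalkAlgebra hx
  have := isLocalization_stalk hx
  exact IsLocalization.isNoetherianRing (chartPrime hx).primeCompl _ inferInstance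

theorem germ_injective {j : Fin (n + 1)} {x : PSpace k n} (hx : x ∈ chart k j) :
    Function.Injective ((PSpace k n).presheaf.germ (chart k j) x hx).hom := by
  let := chartStalkAlgebra hx
  have := isLocalization_stalk hx
  exact IsLocalization.injective (M := (chartPrime hx).primeCompl) _
    (chartPrime hx).primeCompl_le_nonZeroDivisors

section
variable {l : ℕ} (F : MvPolynomial (Fin (n + 1)) k) (hF : F.IsHomogeneous l)

instance : IsClosedImmersion (hypersurfaceι F hF) :=
  inferInstanceAs (IsClosedImmersion (hypersurfaceIdeal F hF).subschemeι)

theorem ker_stalkMap_hypersurfaceι {j : Fin (n + 1)} (y : hypersurface F hF)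
    (hy : hypersurfaceι F hF y ∈ chart k j) :
    RingHom.ker ((hypersurfaceι F hF).stalkMap y).hom =
      Ideal.span {((PSpace k n).presheaf.germ (chart k j) _ hy).hom (localSection F hF j)} := by
  have hI : (hypersurfaceι F hF).ker.ideal (affineChart k j) = Ideal.span {localSection F hF j} :=
    (congrArg (·.ideal (affineChart k j)) (hypersurfaceIdeal F hF).ker_subschemeι).trans
      (hypersurfaceIdeal_ideal_affineChart F hF j)
  refine (IsClosedImmersion.ker_stalkMap _ (affineChart k j) y hy).trans
    ((congrArg (Ideal.map _) hI).trans ((Ideal.map_span _ _).trans ?_))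
  exact congrArg Ideal.span Set.image_singleton

/-- At a regular point of the ambient space that is singular on `V(F)`, the equation of `V(F)`
vanishes to order two. -/
theorem germ_mem_sq_of_mem_singularLocus {j : Fin (n + 1)} {x : PSpace k n} (hx : x ∈ chart k j)
    (hsing : x ∈ hypersurfaceι F hF '' singularLocus (hypersurface F hF))
    (hreg : IsRegularLocalRing ((PSpace k n).presheaf.stalk x)) :
    ((PSpace k n).presheaf.germ (chart k j) x hx).hom (localSection F hF j) ∈
      maximalIdeal ((PSpace k n).presheaf.stalk x) ^ 2 := by
  obtain ⟨y, hy, rfl⟩ := hsing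
  by_contra hf2
  have hker := ker_stalkMap_hypersurfaceι F hF y hx
  refine hy (IsRegularLocalRing.of_surjective_of_ker_eq_span_singleton
    ((hypersurfaceι F hF).stalkMap_surjective y) hker ?_ hf2)
  refine le_maximalIdeal (RingHom.ker_ne_top ((hypersurfaceι F hF).stalkMap y).hom) ?_
  rw [hker]
  exact Ideal.mem_span_singleton_self _

/-- A point at which the equation of `V(F)` vanishes to order two lies on `V(F)` and is singular
there. -/
theorem mem_singularLocus_of_germ_mem_sq (hF0 : F ≠ 0) {j : Fin (n + 1)} {x : PSpace k n}
    (hx : x ∈ chart k j)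
    (hf2 : ((PSpace k n).presheaf.germ (chart k j) x hx).hom (localSection F hF j) ∈
      maximalIdeal ((PSpace k n).presheaf.stalk x) ^ 2) :
    x ∈ hypersurfaceι F hF '' singularLocus (hypersurface F hF) := by
  obtain ⟨y, rfl⟩ : x ∈ Set.range (hypersurfaceι F hF) := by
    change x ∈ Set.range (hypersurfaceIdeal F hF).subschemeι
    rw [Scheme.IdealSheafData.range_subschemeι, SetLike.mem_coe,
      Scheme.IdealSheafData.mem_support_iff_of_mem (U := affineChart k j) hx,
      hypersurfaceIdeal_ideal_affineChart, Scheme.mem_zeroLocus_iff]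
    intro s hs hxs
    have hs' := Ideal.mem_map_of_mem ((PSpace k n).presheaf.germ (chart k j) x hx).hom hs
    rw [Ideal.map_span, Set.image_singleton] at hs'
    refine (mem_maximalIdeal _).mp ?_ (((PSpace k n).mem_basicOpen _ x hx).mp hxs)
    exact (Ideal.span_singleton_le_iff_mem _).mpr (Ideal.pow_le_self two_ne_zero hf2) hs'
  refine ⟨y, ?_, rfl⟩
  refine not_isRegularLocalRing_of_surjective_of_ker_eq_span_singleton
    ((hypersurfaceι F hF).stalkMap_surjective y) (ker_stalkMap_hypersurfaceι F hF y hx) ?_ hf2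
  exact (map_ne_zero_iff _ (germ_injective hx)).mpr (localSection_ne_zero hF hF0 j)

theorem formSection_mem_twistSections_sq_iff (J : (PSpace k n).IdealSheafData) :
    (formSection F hF : ∀ j, Γ(PSpace k n, chart k j)) ∈ twistSections (J ^ 2) l ↔
      ∀ j, localSection F hF j ∈ J.ideal (affineChart k j) ^ 2 :=
  ⟨fun h j ↦ h.1 j, fun h ↦ ⟨h, (formSection F hF).2.2⟩⟩

end

/-- Every prime ideal of functions on a chart that contains the ideal of `C` comes from a point
of `C`. -/
theorem exists_eq_of_isPrime {C : Scheme.{u}} (i : C ⟶ PSpace k n) [IsClosedImmersion i]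
    (j : Fin (n + 1)) (p : Ideal Γ(PSpace k n, chart k j)) [hp : p.IsPrime]
    (hIp : i.ker.ideal (affineChart k j) ≤ p) :
    ∃ (c : C) (hc : i c ∈ chart k j), chartPrime hc = p := by
  have hU : IsAffineOpen (chart k j) := isAffineOpen_chart j
  let P : PrimeSpectrum Γ(PSpace k n, chart k j) := ⟨p, hp⟩
  obtain ⟨⟨x, hx⟩, hxP⟩ : ∃ x : chart k j, hU.primeIdealOf x = P :=
    ⟨hU.isoSpec.inv P, Scheme.inv_hom_apply hU.isoSpec P⟩
  obtain ⟨c, rfl⟩ : x ∈ Set.range i := by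
    rw [← i.isClosedEmbedding.isClosed_range.closure_eq, ← Scheme.Hom.support_ker, SetLike.mem_coe,
      Scheme.IdealSheafData.mem_support_iff_of_mem (U := affineChart k j) hx,
      Scheme.mem_zeroLocus_iff]
    intro s hs hxs
    have hsp : s ∈ chartPrime hx := by
      rw [chartPrime, hxP]
      exact hIp hs
    let := chartStalkAlgebra hx
    have := isLocalization_stalk hx
    exact (IsLocalization.AtPrime.isUnit_to_map_iff ((PSpace k n).presheaf.stalk x)
      (chartPrime hx) s).mp (((PSpace k n).mem_basicOpen _ x hx).mp hxs) hsp
  exact ⟨c, hx, congrArg PrimeSpectrum.asIdeal hxP⟩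

/-- The stalk of the ideal of `C` at a point of `C`, computed on a chart. The ideal is a variable `I`
so that it lives syntactically in `Γ(ℙⁿ, chart k j)` and not in the sections over `affineChart k j`. -/
theorem ker_stalkMap_eq_map {C : Scheme.{u}} (i : C ⟶ PSpace k n) [IsClosedImmersion i]
    {j : Fin (n + 1)} {I : Ideal Γ(PSpace k n, chart k j)}
    (hI : I = i.ker.ideal (affineChart k j)) (c : C) (hc : i c ∈ chart k j) :
    letI := chartStalkAlgebra hc
    RingHom.ker (i.stalkMap c).hom =
      I.map (algebraMap _ ((PSpace k n).presheaf.stalk (i c))) := by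
  subst hI
  exact IsClosedImmersion.ker_stalkMap i (affineChart k j) c hc

theorem isRadical_ker_stalkMap {C X : Scheme.{u}} [IsReduced C] (i : C ⟶ X) [IsClosedImmersion i]
    (c : C) : (RingHom.ker (i.stalkMap c).hom).IsRadical :=
  (RingHom.ker_isRadical_iff_reduced_of_surjective (i.stalkMap_surjective c)).mpr inferInstance

/-- At the generic points of a reduced `C`, the stalk of the ideal of `C` is the maximal ideal. -/
theorem ker_stalkMap_eq_maximalIdeal {C : Scheme.{u}} [IsReduced C] (i : C ⟶ PSpace k n)
    [IsClosedImmersion i] {j : Fin (n + 1)} {I : Ideal Γ(PSpace k n, chart k j)}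
    (hI : I = i.ker.ideal (affineChart k j)) (c : C) (hc : i c ∈ chart k j)
    (hmin : chartPrime hc ∈ I.minimalPrimes) :
    RingHom.ker (i.stalkMap c).hom = maximalIdeal ((PSpace k n).presheaf.stalk (i c)) := by
  have hker := ker_stalkMap_eq_map i hI c hc
  let := chartStalkAlgebra hc
  have := isLocalization_stalk hc
  rw [← IsLocalization.AtPrime.map_eq_maximalIdeal (chartPrime hc),
    ← IsLocalization.AtPrime.radical_map_of_mem_minimalPrimes _ _ _ hmin, ← hker,
    (isRadical_ker_stalkMap i c).radical]

/-- If `C` lies in the singular locus of `V(F)`, the dehomogenizations of `F` lie in the square of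
the ideal of `C`. At a generic point of `C` the ambient local ring is regular, its maximal ideal
being generated by a regular sequence, so the equation lies in the square of the maximal ideal,
which is the ideal of `C`. This spreads to all points of `C`. -/
theorem localSection_mem_ideal_sq {C : Scheme.{u}} [IsReduced C] (i : C ⟶ PSpace k n)
    [IsClosedImmersion i] (hC : IsLocalCompleteIntersection i) {l : ℕ}
    (F : MvPolynomial (Fin (n + 1)) k) (hF : F.IsHomogeneous l)
    (hsing : Set.range i ⊆ hypersurfaceι F hF '' singularLocus (hypersurface F hF))
    (j : Fin (n + 1)) {I : Ideal Γ(PSpace k n, chart k j)}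
    (hI : I = i.ker.ideal (affineChart k j)) : localSection F hF j ∈ I ^ 2 := by
  refine Ideal.mem_sq_of_forall_prime fun p hp hIp ↦ ?_
  obtain ⟨c, hc, rfl⟩ := exists_eq_of_isPrime i j p (hI ▸ hIp)
  have hker := ker_stalkMap_eq_map i hI c hc
  obtain ⟨rs, hrs, hrsI⟩ := hC c
  let := chartStalkAlgebra hc
  have := isLocalization_stalk hc
  refine IsLocalization.AtPrime.exists_mul_mem_sq _ hrs.toIsWeaklyRegular (hrsI.trans hker)
    (hker ▸ isRadical_ker_stalkMap i c) fun q hq ↦ ?_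
  have := hq.1.1
  obtain ⟨c', hc', rfl⟩ := exists_eq_of_isPrime i j q (hI ▸ hq.1.2)
  have hmax := ker_stalkMap_eq_maximalIdeal i hI c' hc' hq
  obtain ⟨rs', hrs', hrsI'⟩ := hC c'
  have hf := germ_mem_sq_of_mem_singularLocus F hF hc' (hsing ⟨c', rfl⟩)
    (.of_isRegular_of_ofList_eq hrs' (hrsI'.trans hmax))
  rw [← hmax, ker_stalkMap_eq_map i hI c' hc', ← Ideal.map_pow] at hf
  let := chartStalkAlgebra hc'
  have := isLocalization_stalk hc'
  exact (IsLocalization.AtPrime.algebraMap_mem_map_iff (chartPrime hc')).mp hf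

theorem mem_singularLocus_of_localSection_mem_ideal_sq {C : Scheme.{u}} (i : C ⟶ PSpace k n)
    [IsClosedImmersion i] {l : ℕ} (F : MvPolynomial (Fin (n + 1)) k) (hF : F.IsHomogeneous l)
    (hF0 : F ≠ 0) {j : Fin (n + 1)} {I : Ideal Γ(PSpace k n, chart k j)}
    (hI : I = i.ker.ideal (affineChart k j)) (hmem : localSection F hF j ∈ I ^ 2)
    (c : C) (hc : i c ∈ chart k j) :
    i c ∈ hypersurfaceι F hF '' singularLocus (hypersurface F hF) := by
  refine mem_singularLocus_of_germ_mem_sq F hF hF0 hc ?_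
  refine Ideal.pow_right_mono (le_maximalIdeal (RingHom.ker_ne_top (i.stalkMap c).hom)) 2 ?_
  rw [ker_stalkMap_eq_map i hI c hc, ← Ideal.map_pow]
  exact Ideal.mem_map_of_mem _ hmem

end SingularAlong

open CategoryTheory AlgebraicGeometry SingularAlong in
theorem mainTheorem5 {k : Type u} [Field k] [IsAlgClosed k] {n l : ℕ} {C : Scheme.{u}}
    (i : C ⟶ PSpace k n) [IsClosedImmersion i] [IsReduced C]
    (hC : IsLocalCompleteIntersection i)
    (F : MvPolynomial (Fin (n + 1)) k) (hF : F.IsHomogeneous l) (hF0 : F ≠ 0) :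
    Set.range i ⊆ hypersurfaceι F hF '' singularLocus (hypersurface F hF) ↔
      (formSection F hF : ∀ j, Γ(PSpace k n, chart k j)) ∈ twistSections (i.ker ^ 2) l := by
  rw [formSection_mem_twistSections_sq_iff]
  constructor
  · exact fun hsing j ↦ localSection_mem_ideal_sq i hC F hF hsing j rfl
  · rintro hmem _ ⟨c, rfl⟩
    obtain ⟨j, hc⟩ := exists_mem_chart (i c)
    exact mem_singularLocus_of_localSection_mem_ideal_sq i F hF hF0 rfl (hmem j) c hc
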